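/- Let $\lambda=(\lambda_1,\dots,\lambda_d)$ be positive integers with $\lambda_1+\cdots+\lambda_d=n\ge 1$, and let $e_1,\dots,e_{d+1}$ be the unit coordinate vectors of $\mathbb{R}^{d+1}$. Let $$\widetilde{\mathcal P}_{d+1}(\lambda)=\operatorname{conv}\{(x,\,x_1^2+\cdots+x_d^2)\;:\;x\in\mathbb{Z}^d,\ 0\le x_i\le\lambda_i\ \text{for}\ 1\le i\le d\}\subset\mathbb{R}^{d+1},$$ and let $\pi(x)=x_1+\cdots+x_d$ for $x\in\mathbb{R}^{d+1}$, which maps $\widetilde{\mathcal P}_{d+1}(\lambda)$ onto $[0,n]$. Let $$\Pi_d(\lambda)=\Big\{\tfrac1n\int_0^n\gamma(t)\,dt\;:\;\gamma:[0,n]\to\widetilde{\mathcal P}_{d+1}(\lambda)\ \text{continuous},\ \pi(\gamma(t))=t\ \text{for all}\ t\in[0,n]\Big\}$$ be the monotone path polytope of this projection. For real $s$ let $$Z_d(\lambda)=[0,\,s\,e_{d+1}]+\sum_{1\le i<j\le d}\ \sum_{k=0}^{\lambda_i-1}\ \sum_{l=0}^{\lambda_j-1}[0,\;e_j-e_i+(2l-2k)\,e_{d+1}]$$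 (a Minkowski sum of segments). The lower (respectively upper) part of a polytope $P\subset\mathbb{R}^{d+1}$ is the union of its lower (respectively upper) faces, that is, of the sets of minimizers (respectively maximizers) on $P$ of linear functionals $c$ with $c(e_{d+1})>0$. Theorem. There are a vector $v\in\mathbb{R}^{d+1}$ and a real number $s_0$ such that for every $s\ge s_0$ the polytope $\Pi_d(\lambda)$ is the upper truncation of $P=v+\frac1n Z_d(\lambda)$ cut by the hyperplane $\lambda_1x_1+\cdots+\lambda_dx_d=x_{d+1}$. That is, $$\Pi_d(\lambda)=P\cap\{x\in\mathbb{R}^{d+1}:\ x_{d+1}\le\lambda_1x_1+\cdots+\lambda_dx_d\},$$ the lower part of $P$ is contained in $\Pi_d(\lambda)$, and no point of the upper part of $P$ satisfies $x_{d+1}<\lambda_1x_1+\cdots+\lambda_dx_d$. -/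

import Mathlib

open MeasureTheory
open scoped Pointwise

namespace PileOfCubes

/-- The monotone path polytope `Π(P, π)` of the projection `π` of `P` onto the line segment
`Q = π(P)`: the set of all average values `(1 / vol Q) ∫_Q γ` of the sections `γ` of `π`, that is,
of the continuous maps `γ : Q → P` with `π ∘ γ = id`. -/
def monotonePathPolytope {E : Type*} [NormedAddCommGroup E] [NormedSpace ℝ E]
    (P : Set E) (π : E →ₗ[ℝ] ℝ) : Set E :=
  {z | ∃ γ : ℝ → E, ContinuousOn γ (π '' P) ∧ (∀ t ∈ π '' P, γ t ∈ P ∧ π (γ t) = t) ∧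
    z = (volume.real (π '' P))⁻¹ • ∫ t in π '' P, γ t}

/-- The last unit coordinate vector `e_{d+1}` of `ℝ^{d+1}`. -/
def eLast (d : ℕ) : Fin (d + 1) → ℝ := Pi.single (Fin.last d) 1

/-- The unit coordinate vector `e_i` of `ℝ^{d+1}`, for one of the first `d` coordinates. -/
def e {d : ℕ} (i : Fin d) : Fin (d + 1) → ℝ := Pi.single i.castSucc 1

/-- A lower face of a polytope in `ℝ^{d+1}`: the set of minimizers on `P` of a linear functional
that is positive on `e_{d+1}`. -/
def IsLowerFace {d : ℕ} (P F : Set (Fin (d + 1) → ℝ)) : Prop :=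
  ∃ c : (Fin (d + 1) → ℝ) →ₗ[ℝ] ℝ, 0 < c (eLast d) ∧ F = {x ∈ P | ∀ y ∈ P, c x ≤ c y}

/-- An upper face of a polytope in `ℝ^{d+1}`: the set of maximizers on `P` of a linear functional
that is positive on `e_{d+1}`. -/
def IsUpperFace {d : ℕ} (P F : Set (Fin (d + 1) → ℝ)) : Prop :=
  ∃ c : (Fin (d + 1) → ℝ) →ₗ[ℝ] ℝ, 0 < c (eLast d) ∧ F = {x ∈ P | ∀ y ∈ P, c y ≤ c x}

/-- The lower part of a polytope: the union of its lower faces. -/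
def lowerPart {d : ℕ} (P : Set (Fin (d + 1) → ℝ)) : Set (Fin (d + 1) → ℝ) :=
  ⋃₀ {F | IsLowerFace P F}

/-- The upper part of a polytope: the union of its upper faces. -/
def upperPart {d : ℕ} (P : Set (Fin (d + 1) → ℝ)) : Set (Fin (d + 1) → ℝ) :=
  ⋃₀ {F | IsUpperFace P F}

/-- `T` is the upper truncation of `P` by the halfspace `a ⬝ x ≤ 0`: it is the intersection of `P`
with the halfspace, it contains the lower part of `P`, and the upper part of `P` does not meet
the region `a ⬝ x < 0`. -/
def IsUpperTruncation {d : ℕ} (T P : Set (Fin (d + 1) → ℝ)) (a : Fin (d + 1) → ℝ) : Prop :=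
  T = P ∩ {x | a ⬝ᵥ x ≤ 0} ∧ lowerPart P ⊆ T ∧ Disjoint (upperPart P) {x | a ⬝ᵥ x < 0}

/-- The `d`-box `B(lam) = {x | 0 ≤ x_i ≤ lam_i}`. -/
def box {d : ℕ} (lam : Fin d → ℕ) : Set (Fin d → ℝ) :=
  {x | ∀ i, 0 ≤ x i ∧ x i ≤ (lam i : ℝ)}

/-- The vertices of the pile of cubes: the integer points of the box. -/
def pileVertices {d : ℕ} (lam : Fin d → ℕ) : Set (Fin d → ℝ) :=
  {x ∈ box lam | ∀ i, ∃ m : ℤ, x i = (m : ℝ)}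

/-- The point `(x, f(x))` of `ℝ^{d+1}`, where `f(x) = x_1² + ⋯ + x_d²`. -/
def lift {d : ℕ} (x : Fin d → ℝ) : Fin (d + 1) → ℝ :=
  Fin.snoc (α := fun _ => ℝ) x (∑ i, x i ^ 2)

/-- The lifted pile of cubes. -/
def liftedPile {d : ℕ} (lam : Fin d → ℕ) : Set (Fin (d + 1) → ℝ) :=
  convexHull ℝ (lift '' pileVertices lam)

/-- The projection `π(x) = x_1 + ⋯ + x_d` on `ℝ^{d+1}`. -/
def sumProj (d : ℕ) : (Fin (d + 1) → ℝ) →ₗ[ℝ] ℝ :=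
  ∑ i : Fin d, LinearMap.proj i.castSucc

/-- The zonotope `Z_d(lam)`, with Minkowski summand `[0, s e_{d+1}]`. -/
def zonotope {d : ℕ} (lam : Fin d → ℕ) (s : ℝ) : Set (Fin (d + 1) → ℝ) :=
  segment ℝ 0 (s • eLast d) +
    ∑ i : Fin d, ∑ j ∈ Finset.Ioi i, ∑ k ∈ Finset.range (lam i), ∑ l ∈ Finset.range (lam j),
      segment ℝ 0 (e j - e i + (2 * (l : ℝ) - 2 * (k : ℝ)) • eLast d)

/-- The vector `a = (-lam_1, …, -lam_d, 1)`; the halfspace `a ⬝ x ≤ 0` is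
`x_{d+1} ≤ lam_1 x_1 + ⋯ + lam_d x_d`. -/
def cutNormal {d : ℕ} (lam : Fin d → ℕ) : Fin (d + 1) → ℝ :=
  Fin.snoc (α := fun _ => ℝ) (fun i => -(lam i : ℝ)) 1

end PileOfCubes

namespace PileOfCubes

/-! ### Minkowski sums and separation -/

/-! After scaling by `n`, the theorem compares the integrals of sections with `basePoint +
coreZonotope`. Both sets have the same lower hull because, for each functional `c` nonnegative on
`eLast`, the integral of one edge path minimizes `c` on both. Points of the pile are sums of edge
vectors `stepVec a` with weights in [0, 1], and the weights sum to the level `t`. So `c` is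
minimized at level `t` by filling the steps greedily by cost. Cost increases weakly along each
direction, so the greedy order comes from a monotone edge path, which stays in the pile
(`exists_isAdmissible`, `sum_mul_ramp_le`, `le_of_mem_sectionIntegrals`). The integral of this path
is `basePoint` plus one difference of edge vectors for each inverted pair of steps
(`edgePathIntegral_eq`), which picks the cheaper end of every segment of the zonotope
(`le_of_mem_coreZonotope`). Separation (`mem_add_ray_of_forall`) turns these minima into inclusions
modulo upward rays. From above, the pile is bounded by the hyperplane of the cut and contains the
vertical projection of each of its points onto it (`vertProj_mem`). Hence section integrals fill
every vertical segment up to the cut, and a long enough vertical summand of the zonotope reaches it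
from everywhere. -/

theorem isCompact_finset_sum {E ι : Type*} [AddCommMonoid E] [TopologicalSpace E] [ContinuousAdd E]
    (s : Finset ι) (A : ι → Set E) (h : ∀ i ∈ s, IsCompact (A i)) : IsCompact (∑ i ∈ s, A i) := by
  classical
  induction s using Finset.induction_on with
  | empty => simp
  | insert a s ha ih =>
    rw [Finset.sum_insert ha]
    exact (h a (by simp)).add (ih fun i hi => h i (by simp [hi]))

theorem isCompact_segment {E : Type*} [AddCommGroup E] [Module ℝ E] [TopologicalSpace E]
    [ContinuousAdd E] [ContinuousSMul ℝ E] (x y : E) : IsCompact (segment ℝ x y) := by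
  rw [segment_eq_image]
  exact isCompact_Icc.image (by fun_prop)

theorem sum_le_of_mem_finset_sum {E ι : Type*} [AddCommMonoid E] [Module ℝ E] (c : E →ₗ[ℝ] ℝ)
    (s : Finset ι) (A : ι → Set E) (m : ι → ℝ) (h : ∀ i ∈ s, ∀ x ∈ A i, m i ≤ c x) :
    ∀ x ∈ ∑ i ∈ s, A i, ∑ i ∈ s, m i ≤ c x := by
  intro x hx
  obtain ⟨g, hg, rfl⟩ := (Set.mem_finsetSum s A x).1 hx
  rw [map_sum]
  exact Finset.sum_le_sum fun i hi => h i hi _ (hg hi)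

theorem min_zero_le_of_mem_segment {E : Type*} [AddCommGroup E] [Module ℝ E] (c : E →ₗ[ℝ] ℝ)
    (w : E) : ∀ x ∈ segment ℝ 0 w, min 0 (c w) ≤ c x := by
  rintro x ⟨a, b, ha, hb, hab, rfl⟩
  simp only [smul_zero, zero_add, map_smul, smul_eq_mul]
  have hb1 : b ≤ 1 := by linarith
  rcases le_total 0 (c w) with h | h
  · rw [min_eq_left h]; positivity
  · rw [min_eq_right h]; nlinarith

/-- The ray of nonnegative multiples of a vector. -/
def ray {E : Type*} [AddCommGroup E] [Module ℝ E] (u : E) : Set E := {x | ∃ r : ℝ, 0 ≤ r ∧ x = r • u}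

theorem convex_ray {E : Type*} [AddCommGroup E] [Module ℝ E] (u : E) : Convex ℝ (ray u) := by
  rintro x ⟨r, hr, rfl⟩ y ⟨s, hs, rfl⟩ a b ha hb _
  exact ⟨a * r + b * s, by positivity, by module⟩

theorem isClosed_ray_eLast (d : ℕ) : IsClosed (ray (eLast d)) := by
  have : ray (eLast d) = {x | 0 ≤ x (Fin.last d) ∧ x = x (Fin.last d) • eLast d} := by
    ext x
    constructor
    · rintro ⟨r, hr, rfl⟩
      simp [eLast, hr]
    · rintro ⟨h1, h2⟩
      exact ⟨_, h1, h2⟩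
  rw [this]
  have hlast : Continuous fun x : Fin (d + 1) → ℝ => x (Fin.last d) := continuous_apply _
  exact (isClosed_le continuous_const hlast).inter
    (isClosed_eq continuous_id (hlast.smul continuous_const))

/-- A point lies in `K + ray u` as soon as no functional nonnegative on `u` separates it from the
compact convex set `K`. -/
theorem mem_add_ray_of_forall {d : ℕ} {K : Set (Fin (d + 1) → ℝ)} (hc : Convex ℝ K)
    (hK : IsCompact K) (z : Fin (d + 1) → ℝ)
    (h : ∀ c : (Fin (d + 1) → ℝ) →ₗ[ℝ] ℝ, 0 ≤ c (eLast d) → ∃ p ∈ K, c p ≤ c z) :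
    z ∈ K + ray (eLast d) := by
  by_contra hz
  obtain ⟨f, u, hu, hf⟩ := geometric_hahn_banach_point_closed (hc.add (convex_ray (eLast d)))
    ((isClosed_ray_eLast d).add_left_of_isCompact hK) hz
  -- The zero functional only serves to produce a point of `K`.
  obtain ⟨p₀, hp₀, -⟩ := h 0 (by simp)
  have key : ∀ p ∈ K, ∀ r : ℝ, 0 ≤ r → u < f p + r * f (eLast d) := by
    intro p hp r hr
    have := hf (p + r • eLast d) (Set.add_mem_add hp ⟨r, hr, rfl⟩)
    simpa using this
  by_cases he : 0 ≤ f (eLast d)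
  · obtain ⟨p, hp, hle⟩ := h f.toLinearMap he
    have h1 := key p hp 0 le_rfl
    have h2 : f p ≤ f z := hle
    linarith
  · push Not at he
    have h1 := key p₀ hp₀ 0 le_rfl
    -- Moving this far up the ray lowers the value of `f` exactly to `u`.
    have h2 := key p₀ hp₀ ((f p₀ - u) / (-f (eLast d))) (div_nonneg (by linarith) (by linarith))
    have h3 : (f p₀ - u) / (-f (eLast d)) * f (eLast d) = -(f p₀ - u) := by
      rw [div_neg, neg_mul, div_mul_cancel₀ _ he.ne]
    linarith

/-! ### Ramps -/

/-- The function that is `0` up to `0`, the identity on `[0, 1]`, and `1` from `1` on. -/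
noncomputable def ramp (t : ℝ) : ℝ := max 0 (min 1 t)

theorem continuous_ramp : Continuous ramp := by unfold ramp; fun_prop

theorem ramp_of_one_le {t : ℝ} (h : 1 ≤ t) : ramp t = 1 := by simp [ramp, h]

theorem ramp_of_nonpos {t : ℝ} (h : t ≤ 0) : ramp t = 0 := by
  simp [ramp, min_eq_right (h.trans zero_le_one), h]

theorem ramp_of_mem {t : ℝ} (h0 : 0 ≤ t) (h1 : t ≤ 1) : ramp t = t := by
  simp [ramp, h0, h1]

/-- The ramps rise one after the other at unit speed; this is what makes an edge path a section. -/
theorem sum_range_ramp (n : ℕ) {t : ℝ} (ht : 0 ≤ t) :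
    ∑ p ∈ Finset.range n, ramp (t - p) = min t n := by
  induction n with
  | zero => simp [ht]
  | succ n ih =>
    rw [Finset.sum_range_succ, ih]
    push_cast
    rcases le_total t n with h | h
    · rw [ramp_of_nonpos (by linarith), min_eq_left h, min_eq_left (by linarith), add_zero]
    · rw [min_eq_right h]
      rcases le_total t (n + 1) with h' | h'
      · rw [ramp_of_mem (by linarith) (by linarith), min_eq_left h']; ring
      · rw [ramp_of_one_le (by linarith), min_eq_right h']

theorem integral_ramp {n p : ℕ} (hp : p < n) :
    ∫ t in Set.Icc (0 : ℝ) n, ramp (t - p) = n - p - 1 / 2 := by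
  have hpn : (p : ℝ) + 1 ≤ n := by exact_mod_cast hp
  have hp0 : (0 : ℝ) ≤ p := p.cast_nonneg
  have hc : Continuous fun t : ℝ => ramp (t - p) := continuous_ramp.comp (by fun_prop)
  rw [integral_Icc_eq_integral_Ioc, ← intervalIntegral.integral_of_le (by linarith),
    ← intervalIntegral.integral_add_adjacent_intervals (b := (p : ℝ))
      (hc.intervalIntegrable _ _) (hc.intervalIntegrable _ _),
    ← intervalIntegral.integral_add_adjacent_intervals (a := (p : ℝ)) (b := (p : ℝ) + 1)
      (hc.intervalIntegrable _ _) (hc.intervalIntegrable _ _)]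
  have h1 : ∫ t in (0 : ℝ)..p, ramp (t - p) = ∫ _ in (0 : ℝ)..p, (0 : ℝ) := by
    refine intervalIntegral.integral_congr fun t ht => ?_
    rw [Set.uIcc_of_le hp0] at ht
    exact ramp_of_nonpos (by linarith [ht.2])
  have h2 : ∫ t in (p : ℝ)..p + 1, ramp (t - p) = ∫ t in (p : ℝ)..p + 1, (t - p) := by
    refine intervalIntegral.integral_congr fun t ht => ?_
    rw [Set.uIcc_of_le (by linarith)] at ht
    exact ramp_of_mem (by linarith [ht.1]) (by linarith [ht.2])
  have h3 : ∫ t in (p : ℝ) + 1..n, ramp (t - p) = ∫ _ in (p : ℝ) + 1..n, (1 : ℝ) := by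
    refine intervalIntegral.integral_congr fun t ht => ?_
    rw [Set.uIcc_of_le hpn] at ht
    exact ramp_of_one_le (by linarith [ht.1])
  rw [h1, h2, h3]
  simp
  ring

/-! ### Rankings -/

/-- `ρ` enumerates the elements of `S` by the ranks `0, …, n - 1`. -/
def IsRanking {ι : Type*} (S : Finset ι) (n : ℕ) (ρ : ι → ℕ) : Prop :=
  Set.BijOn ρ S (Finset.range n)

theorem IsRanking.sum_eq {ι M : Type*} [AddCommMonoid M] {S : Finset ι} {n : ℕ} {ρ : ι → ℕ}
    (h : IsRanking S n ρ) (f : ℕ → M) : ∑ a ∈ S, f (ρ a) = ∑ p ∈ Finset.range n, f p :=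
  Finset.sum_nbij ρ (fun _ ha => h.mapsTo ha) h.injOn h.surjOn fun _ _ => rfl

theorem IsRanking.lt {ι : Type*} {S : Finset ι} {n : ℕ} {ρ : ι → ℕ}
    (h : IsRanking S n ρ) {a : ι} (ha : a ∈ S) : ρ a < n :=
  Finset.mem_range.1 (h.mapsTo ha)

/-- Sort by `f`; ties are broken arbitrarily, so only strict inequalities carry over. -/
theorem exists_isRanking {ι α : Type*} [LinearOrder α] (S : Finset ι) (f : ι → α) :
    ∃ ρ : ι → ℕ, IsRanking S S.card ρ ∧ ∀ a ∈ S, ∀ b ∈ S, f a < f b → ρ a < ρ b := by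
  classical
  let φ : Fin S.card → α := fun p => f (S.equivFin.symm p)
  let σ : S ≃ Fin S.card := S.equivFin.trans (Tuple.sort φ).symm
  have hf : ∀ p, f (σ.symm p) = (φ ∘ Tuple.sort φ) p := fun p => rfl
  refine ⟨fun a => if h : a ∈ S then σ ⟨a, h⟩ else 0, ⟨?_, ?_, ?_⟩, ?_⟩
  · intro a ha
    have ha' : a ∈ S := ha
    simp [ha']
  · intro a ha b hb hab
    have ha' : a ∈ S := ha
    have hb' : b ∈ S := hb
    simp only [ha', hb', dite_true] at hab
    simpa using σ.injective (Fin.ext hab)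
  · intro p hp
    have hp' : p < S.card := by simpa using hp
    refine ⟨σ.symm ⟨p, hp'⟩, (σ.symm ⟨p, hp'⟩).2, ?_⟩
    simp
  · intro a ha b hb hab
    simp only [ha, hb, dite_true]
    by_contra hle
    push Not at hle
    have := Tuple.monotone_sort φ (Fin.le_def.2 hle)
    rw [← hf, ← hf] at this
    simp only [Equiv.symm_apply_apply] at this
    exact absurd hab (not_lt.2 this)

/-- Filling up in the order of increasing weights minimizes the total weight. -/
theorem sum_mul_ramp_le {ι : Type*} {S : Finset ι} {n : ℕ} {ρ : ι → ℕ} (h : IsRanking S n ρ)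
    (c u : ι → ℝ) (hc : ∀ a ∈ S, ∀ b ∈ S, ρ a < ρ b → c a ≤ c b)
    (hu : ∀ a ∈ S, 0 ≤ u a ∧ u a ≤ 1) {t : ℝ} (ht : ∑ a ∈ S, u a = t) :
    ∑ a ∈ S, c a * ramp (t - ρ a) ≤ ∑ a ∈ S, c a * u a := by
  have hcard : S.card = n := by
    have := h.sum_eq fun _ => 1
    simpa using this
  rcases Nat.eq_zero_or_pos n with rfl | hn
  · rw [Finset.card_eq_zero] at hcard
    simp [hcard]
  have ht0 : 0 ≤ t := ht ▸ Finset.sum_nonneg fun a ha => (hu a ha).1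
  have htn : t ≤ n := by
    rw [← ht, ← hcard]
    simpa using Finset.sum_le_sum fun a ha => (hu a ha).2
  have hramp : ∑ a ∈ S, ramp (t - ρ a) = t := by
    rw [h.sum_eq (fun p => ramp (t - p)), sum_range_ramp n ht0, min_eq_left htn]
  -- `m` is the element being filled at time `t`; the minimum covers `t = n`, when all are full.
  obtain ⟨m, hm, hmρ⟩ : ∃ m ∈ S, ρ m = min ⌊t⌋₊ (n - 1) := by
    have : min ⌊t⌋₊ (n - 1) ∈ (Finset.range n : Set ℕ) := by
      simp only [Finset.coe_range, Set.mem_Iio]; omega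
    exact h.surjOn this
  -- Exchange argument: elements before `m` are full and those after it empty, so the two factors
  -- never have opposite signs. Subtracting `c m` changes nothing, as both fillings have total `t`.
  have key : 0 ≤ ∑ a ∈ S, (c a - c m) * (u a - ramp (t - ρ a)) := by
    refine Finset.sum_nonneg fun a ha => ?_
    rcases lt_trichotomy (ρ a) (ρ m) with hlt | heq | hgt
    · have h1 : ρ a + 1 ≤ ⌊t⌋₊ := by omega
      have h2 : ((ρ a + 1 : ℕ) : ℝ) ≤ t := (Nat.le_floor_iff ht0).1 h1
      push_cast at h2
      rw [ramp_of_one_le (by linarith)]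
      have := hc a ha m hm hlt
      have := (hu a ha).2
      nlinarith
    · rw [h.injOn ha hm heq]; simp
    · have h0 := h.lt ha
      have h1 : ⌊t⌋₊ + 1 ≤ ρ a := by omega
      have h2 : t < ρ a := (Nat.lt_floor_add_one t).trans_le (by exact_mod_cast h1)
      rw [ramp_of_nonpos (by linarith), sub_zero]
      exact mul_nonneg (sub_nonneg.2 (hc m hm a ha hgt)) (hu a ha).1
  have expand : ∑ a ∈ S, (c a - c m) * (u a - ramp (t - ρ a))
      = (∑ a ∈ S, c a * u a - ∑ a ∈ S, c a * ramp (t - ρ a))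
        - c m * (∑ a ∈ S, u a - ∑ a ∈ S, ramp (t - ρ a)) := by
    rw [← Finset.sum_sub_distrib, ← Finset.sum_sub_distrib, Finset.mul_sum,
      ← Finset.sum_sub_distrib]
    exact Finset.sum_congr rfl fun a _ => by ring
  rw [expand, ht, hramp] at key
  linarith

variable {d : ℕ}

/-! ### Steps of monotone edge paths in the pile of cubes -/

/-- The steps of a monotone edge path in the box: `⟨i, k⟩` is the step from `x_i = k` to
`x_i = k + 1`. -/
def steps (lam : Fin d → ℕ) : Finset (Σ _ : Fin d, ℕ) :=
  Finset.univ.sigma fun i => Finset.range (lam i)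

/-- The edge vector of a step in the lifted pile. -/
def stepVec (a : Σ _ : Fin d, ℕ) : Fin (d + 1) → ℝ := e a.1 + (2 * (a.2 : ℝ) + 1) • eLast d

theorem mem_steps {lam : Fin d → ℕ} {i : Fin d} {k : ℕ} : ⟨i, k⟩ ∈ steps lam ↔ k < lam i := by
  simp [steps]

theorem card_steps (lam : Fin d → ℕ) : (steps lam).card = ∑ i, lam i := by
  simp [steps]

theorem sum_steps {M : Type*} [AddCommMonoid M] (lam : Fin d → ℕ) (f : (Σ _ : Fin d, ℕ) → M) :
    ∑ a ∈ steps lam, f a = ∑ i, ∑ k ∈ Finset.range (lam i), f ⟨i, k⟩ :=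
  Finset.sum_sigma _ _ _

theorem stepVec_castSucc (a : Σ _ : Fin d, ℕ) (j : Fin d) :
    stepVec a j.castSucc = if a.1 = j then 1 else 0 := by
  simp [stepVec, e, eLast, Pi.single_apply, eq_comm]

theorem stepVec_last (a : Σ _ : Fin d, ℕ) : stepVec a (Fin.last d) = 2 * (a.2 : ℝ) + 1 := by
  simp [stepVec, e, eLast]

theorem sumProj_apply (x : Fin (d + 1) → ℝ) : sumProj d x = ∑ i : Fin d, x i.castSucc := by
  simp [sumProj]

theorem sumProj_stepVec (a : Σ _ : Fin d, ℕ) : sumProj d (stepVec a) = 1 := by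
  simp [sumProj_apply, stepVec_castSucc]

theorem stepVec_sub (i j : Fin d) (k l : ℕ) :
    stepVec ⟨j, l⟩ - stepVec ⟨i, k⟩ = e j - e i + (2 * (l : ℝ) - 2 * (k : ℝ)) • eLast d := by
  simp only [stepVec]; module

theorem sum_range_two_mul_add_one (m : ℕ) :
    ∑ k ∈ Finset.range m, (2 * (k : ℝ) + 1) = (m : ℝ) ^ 2 := by
  induction m with
  | zero => simp
  | succ m ih => rw [Finset.sum_range_succ, ih]; push_cast; ring

theorem lift_natCast (m : Fin d → ℕ) :
    lift (fun i => (m i : ℝ)) = ∑ i, ∑ k ∈ Finset.range (m i), stepVec ⟨i, k⟩ := by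
  ext j
  refine Fin.lastCases ?_ (fun j => ?_) j
  · simp [lift, Finset.sum_apply, stepVec_last, sum_range_two_mul_add_one]
  · simp only [lift, Fin.snoc_castSucc, Finset.sum_apply, stepVec_castSucc]
    rw [Finset.sum_eq_single j (fun i _ hij => by simp [hij]) (by simp)]
    simp

theorem lift_natCast_mem {lam m : Fin d → ℕ} (h : ∀ i, m i ≤ lam i) :
    lift (fun i => (m i : ℝ)) ∈ liftedPile lam := by
  refine subset_convexHull ℝ _ ⟨_, ⟨fun i => ⟨by positivity, ?_⟩, fun i => ⟨m i, by simp⟩⟩, rfl⟩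
  exact_mod_cast h i

/-- A relaxation of the pile to the zonotope of its edge vectors, which forgets that the steps of a
direction come in order. It suffices for lower bounds. -/
theorem exists_weights_of_mem_liftedPile {lam : Fin d → ℕ} {x : Fin (d + 1) → ℝ}
    (hx : x ∈ liftedPile lam) : ∃ u : (Σ _ : Fin d, ℕ) → ℝ,
      (∀ a, 0 ≤ u a ∧ u a ≤ 1) ∧ x = ∑ a ∈ steps lam, u a • stepVec a := by
  let C : Set (Fin (d + 1) → ℝ) := {x | ∃ u : (Σ _ : Fin d, ℕ) → ℝ,
      (∀ a, 0 ≤ u a ∧ u a ≤ 1) ∧ x = ∑ a ∈ steps lam, u a • stepVec a}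
  have hC : Convex ℝ C := by
    rintro x ⟨u, hu, rfl⟩ y ⟨w, hw, rfl⟩ r s hr hs hrs
    refine ⟨fun a => r * u a + s * w a, fun a => ⟨?_, ?_⟩, ?_⟩
    · have := (hu a).1; have := (hw a).1; positivity
    · have := (hu a).2; have := (hw a).2; nlinarith
    · simp only [Finset.smul_sum, ← Finset.sum_add_distrib]
      exact Finset.sum_congr rfl fun a _ => by module
  refine convexHull_min (t := C) ?_ hC hx
  rintro _ ⟨y, ⟨hy, hint⟩, rfl⟩
  have : ∀ i, ∃ m : ℕ, m ≤ lam i ∧ y i = m := by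
    intro i
    obtain ⟨z, hz⟩ := hint i
    have h0 : 0 ≤ z := by exact_mod_cast hz ▸ (hy i).1
    lift z to ℕ using h0
    exact ⟨z, by exact_mod_cast hz ▸ (hy i).2, by simpa using hz⟩
  choose m hm hym using this
  obtain rfl : y = fun i => (m i : ℝ) := funext hym
  refine ⟨fun a => if a.2 < m a.1 then 1 else 0, fun a => by dsimp only; split_ifs <;> simp, ?_⟩
  rw [lift_natCast, sum_steps]
  refine Finset.sum_congr rfl fun i _ => ?_
  simp only [ite_smul, one_smul, zero_smul]
  rw [← Finset.sum_filter]
  refine Finset.sum_congr ?_ fun _ _ => rfl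
  ext k
  have := hm i
  simp only [Finset.mem_range, Finset.mem_filter]
  omega

/-! ### Monotone edge paths -/

/-- The rankings of the steps in which the steps of each direction are in increasing order; they
correspond to the monotone edge paths of the box. -/
structure IsAdmissible (lam : Fin d → ℕ) (ρ : (Σ _ : Fin d, ℕ) → ℕ) : Prop where
  ranking : IsRanking (steps lam) (∑ i, lam i) ρ
  strictMono : ∀ i k l, k < l → l < lam i → ρ ⟨i, k⟩ < ρ ⟨i, l⟩

/-- The section of the lifted pile that makes the steps in the order of their ranks. -/
noncomputable def edgePath (lam : Fin d → ℕ) (ρ : (Σ _ : Fin d, ℕ) → ℕ) (t : ℝ) :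
    Fin (d + 1) → ℝ :=
  ∑ a ∈ steps lam, ramp (t - ρ a) • stepVec a

/-- The integral of `edgePath`. -/
noncomputable def edgePathIntegral (lam : Fin d → ℕ) (ρ : (Σ _ : Fin d, ℕ) → ℕ) :
    Fin (d + 1) → ℝ :=
  ∑ a ∈ steps lam, ((∑ i, lam i : ℕ) - (ρ a : ℝ) - 1 / 2) • stepVec a

theorem continuous_edgePath (lam : Fin d → ℕ) (ρ : (Σ _ : Fin d, ℕ) → ℕ) :
    Continuous (edgePath lam ρ) :=
  continuous_finsetSum _ fun _ _ =>
    (continuous_ramp.comp (continuous_id.sub continuous_const)).smul continuous_const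

theorem sumProj_edgePath {lam : Fin d → ℕ} {ρ : (Σ _ : Fin d, ℕ) → ℕ} (h : IsAdmissible lam ρ)
    {t : ℝ} (ht : t ∈ Set.Icc (0 : ℝ) (∑ i, lam i : ℕ)) : sumProj d (edgePath lam ρ t) = t := by
  simp only [edgePath, map_sum, map_smul, sumProj_stepVec, smul_eq_mul, mul_one]
  rw [h.ranking.sum_eq (fun p => ramp (t - p)), sum_range_ramp _ ht.1, min_eq_left ht.2]

theorem eq_range_card_of_isLowerSet {s : Finset ℕ} (h : ∀ k l, k < l → l ∈ s → k ∈ s) :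
    s = Finset.range s.card := by
  have hsub : ∀ l ∈ s, Finset.range (l + 1) ⊆ s := fun l hl k hk => by
    rcases (Nat.lt_succ_iff.1 (Finset.mem_range.1 hk)).lt_or_eq with h' | rfl
    · exact h k l h' hl
    · exact hl
  refine Finset.eq_of_subset_of_card_le (fun l hl => ?_) (by simp)
  have := Finset.card_le_card (hsub l hl)
  simp only [Finset.card_range] at this
  exact Finset.mem_range.2 this

/-- At time `m` the completed steps form an initial segment in each direction, so their sum is a
lifted lattice point. -/
theorem edgePath_natCast_mem {lam : Fin d → ℕ} {ρ : (Σ _ : Fin d, ℕ) → ℕ}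
    (h : IsAdmissible lam ρ) (m : ℕ) : edgePath lam ρ m ∈ liftedPile lam := by
  let s : Fin d → Finset ℕ := fun i => (Finset.range (lam i)).filter fun k => ρ ⟨i, k⟩ < m
  have hs : ∀ i, s i = Finset.range (s i).card := fun i => by
    refine eq_range_card_of_isLowerSet fun k l hkl hl => ?_
    simp only [s, Finset.mem_filter, Finset.mem_range] at hl ⊢
    exact ⟨hkl.trans hl.1, (h.strictMono i k l hkl hl.1).trans hl.2⟩
  have hle : ∀ i, (s i).card ≤ lam i := fun i => by
    simpa using Finset.card_filter_le (Finset.range (lam i)) fun k => ρ ⟨i, k⟩ < m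
  convert lift_natCast_mem hle using 1
  rw [lift_natCast, edgePath, sum_steps]
  refine Finset.sum_congr rfl fun i _ => ?_
  rw [← hs, Finset.sum_filter]
  refine Finset.sum_congr rfl fun k _ => ?_
  split_ifs with hk
  · have : (ρ ⟨i, k⟩ : ℝ) + 1 ≤ m := by exact_mod_cast hk
    rw [ramp_of_one_le (by linarith), one_smul]
  · have : (m : ℝ) ≤ ρ ⟨i, k⟩ := by exact_mod_cast not_lt.1 hk
    rw [ramp_of_nonpos (by linarith), zero_smul]

theorem ramp_convexCombination (m p : ℕ) {f : ℝ} (h0 : 0 ≤ f) (h1 : f ≤ 1) :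
    ramp (m + f - p) = (1 - f) * ramp (m - p) + f * ramp ((m + 1 : ℕ) - p) := by
  push_cast
  rcases lt_trichotomy m p with h | rfl | h
  · have : (m : ℝ) + 1 ≤ p := by exact_mod_cast h
    rw [ramp_of_nonpos (by linarith), ramp_of_nonpos (by linarith), ramp_of_nonpos (by linarith)]
    ring
  · rw [ramp_of_mem (by linarith) (by linarith), ramp_of_nonpos (by linarith),
      ramp_of_one_le (by linarith)]
    ring
  · have : (p : ℝ) + 1 ≤ m := by exact_mod_cast h
    rw [ramp_of_one_le (by linarith), ramp_of_one_le (by linarith), ramp_of_one_le (by linarith)]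
    ring

theorem edgePath_mem {lam : Fin d → ℕ} {ρ : (Σ _ : Fin d, ℕ) → ℕ}
    (h : IsAdmissible lam ρ) {t : ℝ} (ht : 0 ≤ t) : edgePath lam ρ t ∈ liftedPile lam := by
  have h0 : 0 ≤ t - ⌊t⌋₊ := sub_nonneg.2 (Nat.floor_le ht)
  have h1 : t - ⌊t⌋₊ ≤ 1 := by linarith [Nat.lt_floor_add_one t]
  have key : edgePath lam ρ t = (1 - (t - ⌊t⌋₊)) • edgePath lam ρ ⌊t⌋₊
      + (t - ⌊t⌋₊) • edgePath lam ρ ((⌊t⌋₊ + 1 : ℕ) : ℝ) := by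
    simp only [edgePath, Finset.smul_sum, ← Finset.sum_add_distrib, smul_smul, ← add_smul]
    refine Finset.sum_congr rfl fun a _ => ?_
    rw [← ramp_convexCombination _ _ h0 h1, add_sub_cancel]
  rw [key]
  exact convex_convexHull ℝ _ (edgePath_natCast_mem h _) (edgePath_natCast_mem h _)
    (by linarith) h0 (by ring)

theorem integral_edgePath {lam : Fin d → ℕ} {ρ : (Σ _ : Fin d, ℕ) → ℕ} (h : IsAdmissible lam ρ) :
    ∫ t in Set.Icc (0 : ℝ) (∑ i, lam i : ℕ), edgePath lam ρ t = edgePathIntegral lam ρ := by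
  simp only [edgePath]
  rw [integral_finsetSum]
  · refine Finset.sum_congr rfl fun a ha => ?_
    rw [integral_smul_const, integral_ramp (h.ranking.lt ha)]
  · intro a _
    exact ((continuous_ramp.comp (continuous_id.sub continuous_const)).smul
      continuous_const).continuousOn.integrableOn_compact isCompact_Icc

/-- Within a direction the costs differ by nonnegative multiples of `c (eLast d)`, so sorting by
cost respects the order of steps. The lexicographic second entry settles ties, as when `c (eLast d)
= 0`. -/
theorem exists_isAdmissible (lam : Fin d → ℕ) (c : (Fin (d + 1) → ℝ) →ₗ[ℝ] ℝ)
    (hc : 0 ≤ c (eLast d)) : ∃ ρ, IsAdmissible lam ρ ∧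
      ∀ a ∈ steps lam, ∀ b ∈ steps lam, ρ a < ρ b → c (stepVec a) ≤ c (stepVec b) := by
  obtain ⟨ρ, hρ, hlt⟩ := exists_isRanking (steps lam)
    fun a => toLex ((c (stepVec a), a.2) : ℝ × ℕ)
  rw [card_steps] at hρ
  refine ⟨ρ, ⟨hρ, fun i k l hkl hl => ?_⟩, fun a ha b hb hab => ?_⟩
  · refine hlt _ (mem_steps.2 (hkl.trans hl)) _ (mem_steps.2 hl) ?_
    rw [Prod.Lex.toLex_lt_toLex]
    have hle : c (stepVec ⟨i, k⟩) ≤ c (stepVec ⟨i, l⟩) := by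
      have h1 : c (stepVec ⟨i, l⟩ - stepVec ⟨i, k⟩) = (2 * (l : ℝ) - 2 * k) * c (eLast d) := by
        rw [stepVec_sub]; simp
      have h2 : (k : ℝ) ≤ l := by exact_mod_cast hkl.le
      have h3 : 0 ≤ (2 * (l : ℝ) - 2 * k) * c (eLast d) := mul_nonneg (by linarith) hc
      rw [map_sub] at h1
      linarith
    rcases hle.lt_or_eq with h' | h'
    · exact Or.inl h'
    · exact Or.inr ⟨h', hkl⟩
  · by_contra hcon
    push Not at hcon
    exact absurd (hlt b hb a ha (Prod.Lex.toLex_lt_toLex.2 (Or.inl hcon))) (not_lt.2 hab.le)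

/-! ### The integrals of edge paths and the zonotope -/

/-- The zonotope without its vertical summand. -/
def coreZonotope (lam : Fin d → ℕ) : Set (Fin (d + 1) → ℝ) :=
  ∑ i : Fin d, ∑ j ∈ Finset.Ioi i, ∑ k ∈ Finset.range (lam i), ∑ l ∈ Finset.range (lam j),
    segment ℝ 0 (e j - e i + (2 * (l : ℝ) - 2 * (k : ℝ)) • eLast d)

theorem isCompact_coreZonotope (lam : Fin d → ℕ) : IsCompact (coreZonotope lam) :=
  isCompact_finset_sum _ _ fun _ _ => isCompact_finset_sum _ _ fun _ _ =>
    isCompact_finset_sum _ _ fun _ _ => isCompact_finset_sum _ _ fun _ _ => isCompact_segment _ _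

theorem convex_coreZonotope (lam : Fin d → ℕ) : Convex ℝ (coreZonotope lam) :=
  convex_sum _ fun _ _ => convex_sum _ fun _ _ => convex_sum _ fun _ _ => convex_sum _ fun _ _ =>
    convex_segment _ _

open Classical in
/-- The integral of the edge path that runs through the directions one after the other. -/
noncomputable def basePoint (lam : Fin d → ℕ) : Fin (d + 1) → ℝ :=
  ∑ a ∈ steps lam, (1 / 2 + ∑ b ∈ steps lam,
    if a.1 < b.1 ∨ a.1 = b.1 ∧ a.2 < b.2 then (1 : ℝ) else 0) • stepVec a

/-- Counting the later steps makes the integral a sum over pairs, in which each pair contributes the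
vector of its earlier step. -/
theorem IsAdmissible.coeff_eq {lam : Fin d → ℕ} {ρ : (Σ _ : Fin d, ℕ) → ℕ}
    (h : IsAdmissible lam ρ) {a : Σ _ : Fin d, ℕ} (ha : a ∈ steps lam) :
    ((∑ i, lam i : ℕ) - (ρ a : ℝ) - 1 / 2) =
      1 / 2 + ∑ b ∈ steps lam, if ρ a < ρ b then (1 : ℝ) else 0 := by
  rw [h.ranking.sum_eq fun p => if ρ a < p then (1 : ℝ) else 0]
  have hlt := h.ranking.lt ha
  generalize (∑ i, lam i) = n at hlt
  have : (Finset.range n).filter (fun p => ρ a < p) = Finset.Ico (ρ a + 1) n := by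
    ext p; simp; omega
  rw [Finset.sum_boole, this, Nat.card_Ico, Nat.cast_sub hlt]
  push_cast
  ring

theorem edgePathIntegral_eq {lam : Fin d → ℕ} {ρ : (Σ _ : Fin d, ℕ) → ℕ}
    (h : IsAdmissible lam ρ) :
    edgePathIntegral lam ρ = basePoint lam +
      ∑ i : Fin d, ∑ j ∈ Finset.Ioi i, ∑ k ∈ Finset.range (lam i), ∑ l ∈ Finset.range (lam j),
        if ρ ⟨j, l⟩ < ρ ⟨i, k⟩ then stepVec ⟨j, l⟩ - stepVec ⟨i, k⟩ else 0 := by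
  classical
  let G : (Σ _ : Fin d, ℕ) → (Σ _ : Fin d, ℕ) → Fin (d + 1) → ℝ := fun a b =>
    ((if ρ a < ρ b then (1 : ℝ) else 0) -
      (if a.1 < b.1 ∨ a.1 = b.1 ∧ a.2 < b.2 then (1 : ℝ) else 0)) • stepVec a
  let H : Fin d → Fin d → Fin (d + 1) → ℝ := fun j i =>
    ∑ k ∈ Finset.range (lam i), ∑ l ∈ Finset.range (lam j), G ⟨i, k⟩ ⟨j, l⟩
  have h1 : edgePathIntegral lam ρ - basePoint lam
      = ∑ a ∈ steps lam, ∑ b ∈ steps lam, G a b := by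
    rw [edgePathIntegral, basePoint, ← Finset.sum_sub_distrib]
    refine Finset.sum_congr rfl fun a ha => ?_
    rw [h.coeff_eq ha, ← sub_smul, add_sub_add_left_eq_sub, ← Finset.sum_sub_distrib,
      Finset.sum_smul]
  have h2 : ∑ a ∈ steps lam, ∑ b ∈ steps lam, G a b = ∑ i, ∑ j, H j i := by
    rw [sum_steps]
    refine Finset.sum_congr rfl fun i _ => ?_
    simp only [sum_steps, H]
    exact Finset.sum_comm
  -- Two steps in one direction occur in the same order in every admissible ranking, so only pairs
  -- of distinct directions survive.
  have hdiag : ∀ i, H i i = 0 := fun i => by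
    refine Finset.sum_eq_zero fun k hk => Finset.sum_eq_zero fun l hl => ?_
    rw [Finset.mem_range] at hk hl
    have : ρ ⟨i, k⟩ < ρ ⟨i, l⟩ ↔ k < l := by
      refine ⟨fun hρ => ?_, fun hkl => h.strictMono i k l hkl hl⟩
      by_contra hkl
      rcases (not_lt.1 hkl).lt_or_eq with h' | rfl
      · exact absurd (h.strictMono i l k h' hk) (not_lt.2 hρ.le)
      · exact lt_irrefl _ hρ
    simp [G, this]
  have h3 : ∑ i, ∑ j, H j i = ∑ i, ∑ j ∈ Finset.Ioi i, (H j i + H i j) := by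
    rw [Finset.sum_sum_Ioi_add_eq_sum_sum_off_diag]
    refine Finset.sum_congr rfl fun i _ => ?_
    rw [← Finset.sum_add_sum_compl {i}]
    simp [hdiag]
  rw [← sub_eq_iff_eq_add', h1, h2, h3]
  refine Finset.sum_congr rfl fun i _ => Finset.sum_congr rfl fun j hj => ?_
  have hij : i < j := Finset.mem_Ioi.1 hj
  simp only [H]
  rw [Finset.sum_comm (s := Finset.range (lam j)), ← Finset.sum_add_distrib]
  refine Finset.sum_congr rfl fun k hk => ?_
  rw [← Finset.sum_add_distrib]
  refine Finset.sum_congr rfl fun l hl => ?_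
  have hne : ρ ⟨i, k⟩ ≠ ρ ⟨j, l⟩ := fun heq => by
    have := h.ranking.injOn (mem_steps.2 (Finset.mem_range.1 hk))
      (mem_steps.2 (Finset.mem_range.1 hl)) heq
    exact hij.ne (congrArg Sigma.fst this)
  simp only [G, hij, hij.not_gt, hij.ne', true_or, false_and, or_false, if_true, if_false]
  rcases hne.lt_or_gt with h' | h'
  · simp [h', h'.not_gt]
  · simp only [h', h'.not_gt, if_true, if_false]; module

theorem edgePathIntegral_mem {lam : Fin d → ℕ} {ρ : (Σ _ : Fin d, ℕ) → ℕ}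
    (h : IsAdmissible lam ρ) : ∃ z ∈ coreZonotope lam,
      edgePathIntegral lam ρ = basePoint lam + z := by
  refine ⟨_, ?_, edgePathIntegral_eq h⟩
  refine Set.finsetSum_mem_finsetSum _ _ _ fun i _ => Set.finsetSum_mem_finsetSum _ _ _ fun j _ =>
    Set.finsetSum_mem_finsetSum _ _ _ fun k _ => Set.finsetSum_mem_finsetSum _ _ _ fun l _ => ?_
  rw [stepVec_sub]
  split_ifs
  · exact right_mem_segment _ _ _
  · exact left_mem_segment _ _ _

/-- A pair is inverted only if its difference vector has nonpositive cost, so each segment is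
minimized separately at the end that the path selects. -/
theorem le_of_mem_coreZonotope {lam : Fin d → ℕ} {ρ : (Σ _ : Fin d, ℕ) → ℕ}
    (h : IsAdmissible lam ρ) (c : (Fin (d + 1) → ℝ) →ₗ[ℝ] ℝ)
    (hc : ∀ a ∈ steps lam, ∀ b ∈ steps lam, ρ a < ρ b → c (stepVec a) ≤ c (stepVec b))
    {z : Fin (d + 1) → ℝ} (hz : z ∈ coreZonotope lam) :
    c (edgePathIntegral lam ρ) ≤ c (basePoint lam + z) := by
  rw [edgePathIntegral_eq h, map_add, map_add]
  refine add_le_add le_rfl ?_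
  simp only [map_sum]
  refine sum_le_of_mem_finset_sum c _ _ _ (fun i _ => sum_le_of_mem_finset_sum c _ _ _ fun j _ =>
    sum_le_of_mem_finset_sum c _ _ _ fun k hk => sum_le_of_mem_finset_sum c _ _ _
      fun l hl x hx => ?_) z hz
  rw [← stepVec_sub] at hx
  refine le_trans ?_ (min_zero_le_of_mem_segment c _ x hx)
  rw [map_sub]
  have hi := mem_steps.2 (Finset.mem_range.1 hk)
  have hj := mem_steps.2 (Finset.mem_range.1 hl)
  split_ifs with hlt
  · rw [map_sub]
    exact le_min (sub_nonpos.2 (hc _ hj _ hi hlt)) le_rfl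
  · rw [map_zero]
    refine le_min le_rfl (sub_nonneg.2 ?_)
    rcases (not_lt.1 hlt).lt_or_eq with h' | h'
    · exact hc _ hi _ hj h'
    · rw [h.ranking.injOn hi hj h']

/-! ### The upper hull of the lifted pile -/

/-- The linear functional `x ↦ x_{d+1} - (lam_1 x_1 + ⋯ + lam_d x_d)`. -/
def cutForm (lam : Fin d → ℕ) : (Fin (d + 1) → ℝ) →ₗ[ℝ] ℝ :=
  LinearMap.proj (Fin.last d) - ∑ i : Fin d, (lam i : ℝ) • LinearMap.proj i.castSucc

theorem cutForm_apply (lam : Fin d → ℕ) (x : Fin (d + 1) → ℝ) :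
    cutForm lam x = x (Fin.last d) - ∑ i : Fin d, (lam i : ℝ) * x i.castSucc := by
  simp [cutForm]

theorem cutNormal_dotProduct (lam : Fin d → ℕ) (x : Fin (d + 1) → ℝ) :
    cutNormal lam ⬝ᵥ x = cutForm lam x := by
  simp [cutForm_apply, dotProduct, cutNormal, Fin.sum_univ_castSucc]
  ring

theorem cutForm_eLast (lam : Fin d → ℕ) : cutForm lam (eLast d) = 1 := by
  simp [cutForm_apply, eLast]

theorem sumProj_eLast : sumProj d (eLast d) = 0 := by
  simp [sumProj_apply, eLast]

/-- The vertical projection onto the hyperplane `cutForm lam = 0`. -/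
def vertProj (lam : Fin d → ℕ) : (Fin (d + 1) → ℝ) →ₗ[ℝ] (Fin (d + 1) → ℝ) :=
  LinearMap.id - (cutForm lam).smulRight (eLast d)

theorem vertProj_apply (lam : Fin d → ℕ) (x : Fin (d + 1) → ℝ) :
    vertProj lam x = x - cutForm lam x • eLast d := by
  simp [vertProj]

theorem sumProj_vertProj (lam : Fin d → ℕ) (x : Fin (d + 1) → ℝ) :
    sumProj d (vertProj lam x) = sumProj d x := by
  simp [vertProj_apply, sumProj_eLast]

/-- The affine roof `x ↦ (x, lam_1 x_1 + ⋯ + lam_d x_d)` of the lifted pile. -/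
def roof (lam : Fin d → ℕ) : (Fin d → ℝ) →ₗ[ℝ] (Fin (d + 1) → ℝ) where
  toFun x := Fin.snoc (α := fun _ => ℝ) x (∑ i, (lam i : ℝ) * x i)
  map_add' x y := by
    ext j
    refine Fin.lastCases ?_ (fun j => ?_) j
    · simp [mul_add, Finset.sum_add_distrib]
    · simp
  map_smul' r x := by
    ext j
    refine Fin.lastCases ?_ (fun j => ?_) j
    · simp [Finset.mul_sum, mul_left_comm]
    · simp

theorem vertProj_lift (lam : Fin d → ℕ) (x : Fin d → ℝ) :
    vertProj lam (lift x) = roof lam x := by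
  ext j
  refine Fin.lastCases ?_ (fun j => ?_) j
  · simp [vertProj_apply, cutForm_apply, roof, lift, eLast]
  · simp [vertProj_apply, roof, lift, eLast]

/-- At the corners of the box each coordinate satisfies `y² = lam y`, so the linear roof agrees with
the lift there; the rest follows by convexity. -/
theorem roof_mem {lam : Fin d → ℕ} {x : Fin d → ℝ} (hx : x ∈ box lam) :
    roof lam x ∈ liftedPile lam := by
  have hbox : x ∈ convexHull ℝ (Set.pi Set.univ fun i : Fin d => ({0, (lam i : ℝ)} : Set ℝ)) := by
    rw [convexHull_pi]
    intro i _
    dsimp only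
    rw [convexHull_pair, segment_eq_Icc (by positivity)]
    exact hx i
  have hconv : Convex ℝ (roof lam ⁻¹' liftedPile lam) :=
    (convex_convexHull ℝ _).linear_preimage (roof lam)
  refine convexHull_min ?_ hconv hbox
  intro y hy
  have hy' : ∀ i, y i = 0 ∨ y i = lam i := fun i => by simpa using hy i (Set.mem_univ i)
  have hlift : roof lam y = lift y := by
    simp only [roof, lift, LinearMap.coe_mk, AddHom.coe_mk]
    congr 1
    refine Finset.sum_congr rfl fun i _ => ?_
    rcases hy' i with h | h <;> rw [h] <;> ring
  rw [Set.mem_preimage, hlift]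
  refine subset_convexHull ℝ _ ⟨y, ⟨fun i => ?_, fun i => ?_⟩, rfl⟩
  · rcases hy' i with h | h <;> rw [h] <;> simp
  · rcases hy' i with h | h
    · exact ⟨0, by simp [h]⟩
    · exact ⟨lam i, by simp [h]⟩

theorem vertProj_mem {lam : Fin d → ℕ} {x : Fin (d + 1) → ℝ} (hx : x ∈ liftedPile lam) :
    vertProj lam x ∈ liftedPile lam := by
  have hconv : Convex ℝ (vertProj lam ⁻¹' liftedPile lam) :=
    (convex_convexHull ℝ _).linear_preimage (vertProj lam)
  refine convexHull_min ?_ hconv hx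
  rintro _ ⟨y, hy, rfl⟩
  rw [Set.mem_preimage, vertProj_lift]
  exact roof_mem hy.1

theorem cutForm_nonpos_of_mem {lam : Fin d → ℕ} {x : Fin (d + 1) → ℝ} (hx : x ∈ liftedPile lam) :
    cutForm lam x ≤ 0 := by
  have hconv : Convex ℝ {x | cutForm lam x ≤ 0} := convex_halfSpace_le (cutForm lam).isLinear 0
  refine convexHull_min ?_ hconv hx
  rintro _ ⟨y, hy, rfl⟩
  simp only [Set.mem_ofPred_eq, cutForm_apply, lift, Fin.snoc_last, Fin.snoc_castSucc, sub_nonpos]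
  refine Finset.sum_le_sum fun i _ => ?_
  have := hy.1 i
  nlinarith

/-! ### Integrals of sections -/

theorem image_sumProj_liftedPile {lam : Fin d → ℕ} :
    sumProj d '' liftedPile lam = Set.Icc (0 : ℝ) (∑ i, lam i : ℕ) := by
  apply subset_antisymm
  · rintro _ ⟨x, hx, rfl⟩
    obtain ⟨u, hu, rfl⟩ := exists_weights_of_mem_liftedPile hx
    simp only [map_sum, map_smul, sumProj_stepVec, smul_eq_mul, mul_one]
    refine ⟨Finset.sum_nonneg fun a _ => (hu a).1, ?_⟩
    rw [← card_steps]
    simpa using Finset.sum_le_sum fun a (_ : a ∈ steps lam) => (hu a).2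
  · intro t ht
    obtain ⟨ρ, hρ, -⟩ := exists_isAdmissible lam 0 (by simp)
    exact ⟨_, edgePath_mem hρ ht.1, sumProj_edgePath hρ ht⟩

/-- The integrals of the sections of the projection of the lifted pile. -/
def sectionIntegrals (lam : Fin d → ℕ) : Set (Fin (d + 1) → ℝ) :=
  {z | ∃ γ : ℝ → Fin (d + 1) → ℝ, ContinuousOn γ (Set.Icc (0 : ℝ) (∑ i, lam i : ℕ)) ∧
    (∀ t ∈ Set.Icc (0 : ℝ) (∑ i, lam i : ℕ), γ t ∈ liftedPile lam ∧ sumProj d (γ t) = t) ∧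
    z = ∫ t in Set.Icc (0 : ℝ) (∑ i, lam i : ℕ), γ t}

theorem mem_monotonePathPolytope_iff {lam : Fin d → ℕ} (hn : 0 < ∑ i, lam i)
    (x : Fin (d + 1) → ℝ) :
    x ∈ monotonePathPolytope (liftedPile lam) (sumProj d) ↔
      ((∑ i, lam i : ℕ) : ℝ) • x ∈ sectionIntegrals lam := by
  have hn' : ((∑ i, lam i : ℕ) : ℝ) ≠ 0 := by exact_mod_cast hn.ne'
  simp only [monotonePathPolytope, sectionIntegrals, image_sumProj_liftedPile, Set.mem_ofPred_eq]
  have hvol : volume.real (Set.Icc (0 : ℝ) (∑ i, lam i : ℕ)) = (∑ i, lam i : ℕ) := by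
    rw [Real.volume_real_Icc_of_le (by positivity), sub_zero]
  rw [hvol]
  refine exists_congr fun γ => and_congr_right fun _ => and_congr_right fun _ => ?_
  rw [eq_inv_smul_iff₀ hn']

theorem convex_sectionIntegrals (lam : Fin d → ℕ) : Convex ℝ (sectionIntegrals lam) := by
  rintro _ ⟨γ, hγ, hγs, rfl⟩ _ ⟨δ, hδ, hδs, rfl⟩ a b ha hb hab
  refine ⟨fun t => a • γ t + b • δ t, (hγ.const_smul a).add (hδ.const_smul b), fun t ht => ⟨?_, ?_⟩,
    ?_⟩
  · exact convex_convexHull ℝ _ (hγs t ht).1 (hδs t ht).1 ha hb hab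
  · simp only [map_add, map_smul, (hγs t ht).2, (hδs t ht).2, smul_eq_mul, ← add_mul, hab, one_mul]
  · rw [← integral_smul, ← integral_smul]
    exact (integral_add ((hγ.integrableOn_compact isCompact_Icc).smul a)
      ((hδ.integrableOn_compact isCompact_Icc).smul b)).symm

theorem edgePathIntegral_mem_sectionIntegrals {lam : Fin d → ℕ} {ρ : (Σ _ : Fin d, ℕ) → ℕ}
    (h : IsAdmissible lam ρ) : edgePathIntegral lam ρ ∈ sectionIntegrals lam :=
  ⟨edgePath lam ρ, (continuous_edgePath lam ρ).continuousOn,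
    fun _ ht => ⟨edgePath_mem h ht.1, sumProj_edgePath h ht⟩, (integral_edgePath h).symm⟩

theorem map_setIntegral_Icc {F : Type*} [NormedAddCommGroup F] [NormedSpace ℝ F] [CompleteSpace F]
    (T : (Fin (d + 1) → ℝ) →ₗ[ℝ] F) {γ : ℝ → Fin (d + 1) → ℝ} {a b : ℝ}
    (hγ : ContinuousOn γ (Set.Icc a b)) :
    T (∫ t in Set.Icc a b, γ t) = ∫ t in Set.Icc a b, T (γ t) :=
  (T.toContinuousLinearMap.integral_comp_comm (hγ.integrableOn_compact isCompact_Icc)).symm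

theorem vertProj_mem_sectionIntegrals {lam : Fin d → ℕ} {z : Fin (d + 1) → ℝ}
    (hz : z ∈ sectionIntegrals lam) : vertProj lam z ∈ sectionIntegrals lam := by
  obtain ⟨γ, hγ, hγs, rfl⟩ := hz
  refine ⟨fun t => vertProj lam (γ t), ?_, fun t ht => ⟨vertProj_mem (hγs t ht).1, ?_⟩,
    map_setIntegral_Icc _ hγ⟩
  · exact (vertProj lam).continuous_of_finiteDimensional.comp_continuousOn hγ
  · rw [sumProj_vertProj, (hγs t ht).2]

theorem cutForm_nonpos_of_mem_sectionIntegrals {lam : Fin d → ℕ} {z : Fin (d + 1) → ℝ}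
    (hz : z ∈ sectionIntegrals lam) : cutForm lam z ≤ 0 := by
  obtain ⟨γ, hγ, hγs, rfl⟩ := hz
  rw [map_setIntegral_Icc _ hγ]
  exact setIntegral_nonpos measurableSet_Icc fun t ht => cutForm_nonpos_of_mem (hγs t ht).1

theorem le_of_mem_sectionIntegrals {lam : Fin d → ℕ} {ρ : (Σ _ : Fin d, ℕ) → ℕ}
    (h : IsAdmissible lam ρ) (c : (Fin (d + 1) → ℝ) →ₗ[ℝ] ℝ)
    (hc : ∀ a ∈ steps lam, ∀ b ∈ steps lam, ρ a < ρ b → c (stepVec a) ≤ c (stepVec b))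
    {z : Fin (d + 1) → ℝ} (hz : z ∈ sectionIntegrals lam) :
    c (edgePathIntegral lam ρ) ≤ c z := by
  obtain ⟨γ, hγ, hγs, rfl⟩ := hz
  rw [← integral_edgePath h, map_setIntegral_Icc _ (continuous_edgePath lam ρ).continuousOn,
    map_setIntegral_Icc _ hγ]
  have hcc := c.continuous_of_finiteDimensional
  refine setIntegral_mono_on
    ((hcc.comp (continuous_edgePath lam ρ)).continuousOn.integrableOn_compact isCompact_Icc)
    ((hcc.comp_continuousOn hγ).integrableOn_compact isCompact_Icc) measurableSet_Icc
    fun t ht => ?_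
  obtain ⟨hmem, hsum⟩ := hγs t ht
  obtain ⟨u, hu, hγu⟩ := exists_weights_of_mem_liftedPile hmem
  rw [hγu] at hsum ⊢
  simp only [map_sum, map_smul, sumProj_stepVec, smul_eq_mul, mul_one] at hsum
  simp only [edgePath, map_sum, map_smul, smul_eq_mul, mul_comm _ (c _)]
  exact sum_mul_ramp_le h.ranking (fun a => c (stepVec a)) u hc (fun a _ => hu a) hsum

/-- The point lies on the segment from `z` to its vertical projection onto the cut, whose ends are
both section integrals. -/
theorem add_smul_eLast_mem_sectionIntegrals {lam : Fin d → ℕ} {z : Fin (d + 1) → ℝ}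
    (hz : z ∈ sectionIntegrals lam) {r : ℝ} (hr : 0 ≤ r)
    (hcut : cutForm lam (z + r • eLast d) ≤ 0) : z + r • eLast d ∈ sectionIntegrals lam := by
  have h := cutForm_nonpos_of_mem_sectionIntegrals hz
  simp only [map_add, map_smul, cutForm_eLast, smul_eq_mul, mul_one] at hcut
  rcases h.lt_or_eq with hlt | heq
  · have hpos : 0 < -cutForm lam z := by linarith
    have hle : r / -cutForm lam z ≤ 1 := (div_le_one hpos).2 (by linarith)
    have := convex_sectionIntegrals lam hz (vertProj_mem_sectionIntegrals hz)
      (sub_nonneg.2 hle) (div_nonneg hr hpos.le) (by ring)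
    convert this using 1
    have hmul : r = r / -cutForm lam z * -cutForm lam z := (div_mul_cancel₀ _ hpos.ne').symm
    rw [vertProj_apply]
    nth_rewrite 1 [hmul]
    module
  · have : r = 0 := by linarith
    simpa [this] using hz

/-! ### Comparison of the zonotope and the integrals of sections -/

/-- The integrals of the edge paths. -/
def edgePathIntegrals (lam : Fin d → ℕ) : Set (Fin (d + 1) → ℝ) :=
  {z | ∃ ρ, IsAdmissible lam ρ ∧ z = edgePathIntegral lam ρ}

/-- Infinitely many `ρ` are admissible, but only their values on `steps lam` enter the integral.
Finiteness makes the hull compact, as separation requires. -/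
theorem finite_edgePathIntegrals (lam : Fin d → ℕ) : (edgePathIntegrals lam).Finite := by
  let F : (steps lam → Fin (∑ i, lam i)) → Fin (d + 1) → ℝ := fun ρ =>
    ∑ a : steps lam, ((∑ i, lam i : ℕ) - ((ρ a : ℕ) : ℝ) - 1 / 2) • stepVec a.1
  refine (Set.finite_range F).subset ?_
  rintro _ ⟨ρ, hρ, rfl⟩
  refine ⟨fun a => ⟨ρ a, hρ.ranking.lt a.2⟩, ?_⟩
  exact Finset.sum_coe_sort (steps lam) fun a =>
    ((∑ i, lam i : ℕ) - (ρ a : ℝ) - 1 / 2) • stepVec a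

theorem basePoint_add_mem {lam : Fin d → ℕ} {w : Fin (d + 1) → ℝ} (hw : w ∈ coreZonotope lam) :
    basePoint lam + w ∈ convexHull ℝ (edgePathIntegrals lam) + ray (eLast d) := by
  refine mem_add_ray_of_forall (convex_convexHull ℝ _)
    ((finite_edgePathIntegrals lam).isCompact_convexHull ℝ) _ fun c hc => ?_
  obtain ⟨ρ, hρ, hρc⟩ := exists_isAdmissible lam c hc
  exact ⟨_, subset_convexHull ℝ _ ⟨ρ, hρ, rfl⟩, le_of_mem_coreZonotope hρ c hρc hw⟩

theorem convexHull_edgePathIntegrals_subset (lam : Fin d → ℕ) :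
    convexHull ℝ (edgePathIntegrals lam) ⊆ {basePoint lam} + coreZonotope lam := by
  refine convexHull_min ?_ ((convex_singleton _).add (convex_coreZonotope lam))
  rintro _ ⟨ρ, hρ, rfl⟩
  obtain ⟨z, hz, h⟩ := edgePathIntegral_mem hρ
  exact h ▸ Set.add_mem_add rfl hz

theorem convexHull_edgePathIntegrals_subset_sectionIntegrals (lam : Fin d → ℕ) :
    convexHull ℝ (edgePathIntegrals lam) ⊆ sectionIntegrals lam := by
  refine convexHull_min ?_ (convex_sectionIntegrals lam)
  rintro _ ⟨ρ, hρ, rfl⟩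
  exact edgePathIntegral_mem_sectionIntegrals hρ

theorem exists_of_mem_sectionIntegrals {lam : Fin d → ℕ} {z : Fin (d + 1) → ℝ}
    (hz : z ∈ sectionIntegrals lam) :
    ∃ w ∈ coreZonotope lam, ∃ r : ℝ, 0 ≤ r ∧ z = basePoint lam + w + r • eLast d := by
  have : z ∈ ({basePoint lam} + coreZonotope lam) + ray (eLast d) := by
    refine mem_add_ray_of_forall ((convex_singleton _).add (convex_coreZonotope lam))
      (isCompact_singleton.add (isCompact_coreZonotope lam)) _ fun c hc => ?_
    obtain ⟨ρ, hρ, hρc⟩ := exists_isAdmissible lam c hc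
    exact ⟨_, convexHull_edgePathIntegrals_subset lam (subset_convexHull ℝ _ ⟨ρ, hρ, rfl⟩),
      le_of_mem_sectionIntegrals hρ c hρc hz⟩
  obtain ⟨_, ⟨_, rfl, w, hw, rfl⟩, _, ⟨r, hr, rfl⟩, rfl⟩ := this
  exact ⟨w, hw, r, hr, rfl⟩

theorem mem_zonotope_iff {lam : Fin d → ℕ} {s : ℝ} (hs : 0 ≤ s) (z : Fin (d + 1) → ℝ) :
    z ∈ zonotope lam s ↔
      ∃ w ∈ coreZonotope lam, ∃ r : ℝ, 0 ≤ r ∧ r ≤ s ∧ z = w + r • eLast d := by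
  constructor
  · rintro ⟨_, ⟨a, b, ha, hb, hab, rfl⟩, w, hw, rfl⟩
    refine ⟨w, hw, b * s, by positivity, by nlinarith, ?_⟩
    simp only [smul_zero, zero_add, smul_smul]
    exact add_comm _ _
  · rintro ⟨w, hw, r, hr, hrs, rfl⟩
    rw [add_comm w]
    refine Set.add_mem_add ?_ hw
    rcases hs.eq_or_lt with rfl | hs
    · obtain rfl : r = 0 := le_antisymm hrs hr
      simp
    · refine ⟨1 - r / s, r / s, sub_nonneg.2 ((div_le_one hs).2 hrs), by positivity, by ring, ?_⟩
      rw [smul_zero, zero_add, smul_smul, div_mul_cancel₀ _ hs.ne']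

/-- Since `cutForm` is 1 on `eLast`, a vertical summand of length `s₀` reaches the cut from every
point of the translated core. -/
theorem exists_cutForm_bound (lam : Fin d → ℕ) :
    ∃ s₀ : ℝ, 0 ≤ s₀ ∧ ∀ w ∈ coreZonotope lam, -s₀ ≤ cutForm lam (basePoint lam + w) := by
  have hcont : Continuous fun w => cutForm lam (basePoint lam + w) :=
    (cutForm lam).continuous_of_finiteDimensional.comp (continuous_const.add continuous_id)
  obtain ⟨m, hm⟩ := ((isCompact_coreZonotope lam).image hcont).bddBelow
  refine ⟨max 0 (-m), le_max_left _ _, fun w hw => ?_⟩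
  have h1 := hm ⟨w, hw, rfl⟩
  have h2 := le_max_right 0 (-m)
  dsimp only at h1
  linarith

end PileOfCubes

open PileOfCubes in
theorem theorem2p1 (d n : ℕ) (hn : 0 < n) (lam : Fin d → ℕ) (hlam : ∀ i, 0 < lam i)
    (hsum : ∑ i, lam i = n) :
    ∃ (v : Fin (d + 1) → ℝ) (s₀ : ℝ), ∀ s : ℝ, s₀ ≤ s →
      PileOfCubes.IsUpperTruncation
        (PileOfCubes.monotonePathPolytope (PileOfCubes.liftedPile lam) (PileOfCubes.sumProj d))
        ((fun x => v + x) '' ((1 / (n : ℝ)) • PileOfCubes.zonotope lam s))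
        (PileOfCubes.cutNormal lam) := by
  obtain ⟨s₀, hs₀, hbound⟩ := exists_cutForm_bound lam
  have hn' : 0 < (n : ℝ) := by exact_mod_cast hn
  refine ⟨(n : ℝ)⁻¹ • basePoint lam, s₀, fun s hs => ?_⟩
  have hQ : ∀ x, x ∈ monotonePathPolytope (liftedPile lam) (sumProj d) ↔
      (n : ℝ) • x ∈ sectionIntegrals lam := by
    subst hsum
    exact mem_monotonePathPolytope_iff hn
  generalize monotonePathPolytope (liftedPile lam) (sumProj d) = Q at hQ ⊢
  have hP : ∀ x, x ∈ (fun x => (n : ℝ)⁻¹ • basePoint lam + x) '' ((1 / (n : ℝ)) • zonotope lam s) ↔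
      ∃ w ∈ coreZonotope lam, ∃ r : ℝ, 0 ≤ r ∧ r ≤ s ∧
        (n : ℝ) • x = basePoint lam + w + r • eLast d := by
    intro x
    constructor
    · rintro ⟨_, ⟨z, hz, rfl⟩, rfl⟩
      obtain ⟨w, hw, r, hr, hrs, rfl⟩ := (mem_zonotope_iff (hs₀.trans hs) z).1 hz
      refine ⟨w, hw, r, hr, hrs, ?_⟩
      simp only [one_div, ← smul_add, smul_inv_smul₀ hn'.ne', add_assoc]
    · rintro ⟨w, hw, r, hr, hrs, hx⟩
      refine ⟨_, ⟨w + r • eLast d, (mem_zonotope_iff (hs₀.trans hs) _).2 ⟨w, hw, r, hr, hrs, rfl⟩,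
        rfl⟩, ?_⟩
      simp only [one_div, ← smul_add, ← add_assoc]
      rw [← hx, inv_smul_smul₀ hn'.ne']
  generalize (fun x => (n : ℝ)⁻¹ • basePoint lam + x) '' ((1 / (n : ℝ)) • zonotope lam s) = P
    at hP ⊢
  have hcut : ∀ x, cutForm lam ((n : ℝ) • x) = n * (cutNormal lam ⬝ᵥ x) := fun x => by
    rw [cutNormal_dotProduct, map_smul, smul_eq_mul]
  have hdecomp : ∀ x ∈ P, ∃ y ∈ convexHull ℝ (edgePathIntegrals lam), ∃ r : ℝ, 0 ≤ r ∧
      (n : ℝ) • x = y + r • eLast d := by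
    intro x hx
    obtain ⟨w, hw, r, hr, -, hx⟩ := (hP x).1 hx
    obtain ⟨y, hy, _, ⟨r', hr', rfl⟩, hyw⟩ := basePoint_add_mem hw
    refine ⟨y, hy, r' + r, by positivity, ?_⟩
    rw [hx, ← hyw, add_smul, add_assoc]
  refine ⟨?_, ?_, ?_⟩
  · ext x
    rw [hQ]
    constructor
    · intro hx
      have hneg := cutForm_nonpos_of_mem_sectionIntegrals hx
      obtain ⟨w, hw, r, hr, hxw⟩ := exists_of_mem_sectionIntegrals hx
      refine ⟨(hP x).2 ⟨w, hw, r, hr, ?_, hxw⟩, ?_⟩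
      · have h1 := hbound w hw
        rw [hxw, map_add, map_smul, cutForm_eLast, smul_eq_mul, mul_one] at hneg
        linarith
      · rw [hcut] at hneg
        exact nonpos_of_mul_nonpos_right hneg hn'
    · rintro ⟨hx, hle⟩
      obtain ⟨y, hy, r, hr, hxy⟩ := hdecomp x hx
      rw [hxy]
      refine add_smul_eLast_mem_sectionIntegrals
        (convexHull_edgePathIntegrals_subset_sectionIntegrals lam hy) hr ?_
      rw [← hxy, hcut]
      exact mul_nonpos_of_nonneg_of_nonpos hn'.le hle
  · rintro x ⟨_, ⟨c, hc, rfl⟩, hx, hmin⟩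
    obtain ⟨y, hy, r, hr, hxy⟩ := hdecomp x hx
    obtain ⟨_, rfl, w, hw, hyw⟩ := convexHull_edgePathIntegrals_subset lam hy
    have hyP : (n : ℝ)⁻¹ • y ∈ P := (hP _).2 ⟨w, hw, 0, le_rfl, hs₀.trans hs, by
      rw [smul_inv_smul₀ hn'.ne', zero_smul, add_zero]; exact hyw.symm⟩
    have h1 := mul_le_mul_of_nonneg_left (hmin _ hyP) hn'.le
    rw [← smul_eq_mul, ← smul_eq_mul, ← map_smul, ← map_smul, smul_inv_smul₀ hn'.ne', hxy, map_add,
      map_smul, smul_eq_mul] at h1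
    -- The point `n⁻¹ • y` of `P` lies vertically below `x` and `c` is positive on `eLast`, so
    -- minimality leaves no room for `r > 0`.
    have hr0 : r = 0 := by nlinarith
    rw [hQ, hxy, hr0, zero_smul, add_zero]
    exact convexHull_edgePathIntegrals_subset_sectionIntegrals lam hy
  · rw [Set.disjoint_left]
    rintro x ⟨_, ⟨c, hc, rfl⟩, hx, hmax⟩ hneg
    obtain ⟨w, hw, r, hr, hrs, hxw⟩ := (hP x).1 hx
    have htop : (n : ℝ)⁻¹ • (basePoint lam + w + s • eLast d) ∈ P :=
      (hP _).2 ⟨w, hw, s, hs₀.trans hs, le_rfl, smul_inv_smul₀ hn'.ne' _⟩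
    have h1 := mul_le_mul_of_nonneg_left (hmax _ htop) hn'.le
    rw [← smul_eq_mul, ← smul_eq_mul, ← map_smul, ← map_smul, smul_inv_smul₀ hn'.ne', hxw, map_add,
      map_add _ _ (r • _), map_smul, map_smul, smul_eq_mul, smul_eq_mul] at h1
    -- A maximizer must use the full vertical summand, which by the choice of `s₀` puts it on or
    -- above the cut.
    have hsr : s ≤ r := le_of_mul_le_mul_right (by linarith) hc
    have h2 := hbound w hw
    have h3 := hcut x
    rw [hxw, map_add, map_smul, cutForm_eLast, smul_eq_mul, mul_one] at h3
    have h4 : (n : ℝ) * (cutNormal lam ⬝ᵥ x) < 0 := mul_neg_of_pos_of_neg hn' hneg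
    linarith
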